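/- A fair division instance with $n\ge 1$ agents $N=\{1,\dots,n\}$ consists of a finite set $M$ of indivisible goods, a finite set $D$ of homogeneous divisible goods (either may be empty), and non-negative utilities $u_i(g)$ for $i\in N$, $g\in M\cup D$. These utilities are arbitrary ("unscaled"): no normalization is imposed. A bundle $(M',\mathbf x')$ consists of a set $M'\subseteq M$ and a vector $\mathbf x'\in[0,1]^D$, and has utility $u_i(M',\mathbf x')=\sum_{g\in M'}u_i(g)+\sum_{d\in D}x'_d\,u_i(d)$ for agent $i$; write $u_i(M\cup D)=\sum_{g\in M\cup D}u_i(g)$. A (possibly partial) allocation $\mathcal A=(A_1,\dots,A_n)$ gives each agent $i$ a bundle $A_i=(M_i,\mathbf x_i)$ such that the sets $M_i$ are pairwise disjoint and $\sum_i x_{id}\le 1$ for every $d\in D$; it is complete if $\bigcup_i M_i=M$ and $\sum_i x_{id}=1$ for every $d\in D$. Its social welfare is $\mathsf{SW}(\mathcal A)=\sum_{i\in N}u_i(A_i)$. An allocation is EFM if for all $i,j\in N$: when $\mathbf x_j=\mathbf 0$, either $u_i(A_i)\ge u_i(A_j)$ or $u_i(A_i)\ge u_i(M_j\setminus\{g\},\mathbf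 x_j)$ for some $g\in M_j$; and when $\mathbf x_j\ne\mathbf 0$, $u_i(A_i)\ge u_i(A_j)$. EFXM is defined in the same way with "for every $g\in M_j$" in place of "for some $g\in M_j$". When $D=\emptyset$, an allocation is EF1 if for all $i,j\in N$ with $M_j\neq\emptyset$ there is $g\in M_j$ with $u_i(M_i)\ge u_i(M_j\setminus\{g\})$. For a fairness property $P$, the price of $P$ for an instance is the ratio of the maximum social welfare of all its allocations to the maximum social welfare of its (possibly partial) allocations satisfying $P$. (The ratio is $\infty$ if only the denominator is $0$; instances for which both are $0$ are disregarded.) The price of $P$ for $n$ agents is the supremum of this ratio over all instances with $n$ agents; for EF1 only instances with $D=\emptyset$ are considered. **Theorem.** With unscaled utilities, the price of EFM and the price of EFXM for $n$ agents are both $\Theta(n)$: for each of the two there are absolute constants $c,C>0$ such that the price lies between $cn$ and $Cn$ for every $n\ge 1$. Already the price of EF1 for $n$ agents (over instances with indivisible goods only) is $\Omega(n)$: it is at least $c'n$ for every $n\ge1$, with an absolute constant $c'>0$. Moreover, every instance with $n\ge 1$ agents has 1. a (possibly partial) EFXM allocation $\mathcal A$ with $\mathsf{SW}(\mathcal A)\ge\frac{1}{2n+1}\sum_{i\in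 N}u_i(M\cup D)$, and 2. a complete EFM allocation $\mathcal A$ with $\mathsf{SW}(\mathcal A)\ge\frac{1}{2n}\sum_{i\in N}u_i(M\cup D)$. -/

import Mathlib

open scoped ENNReal

namespace FairDivision

/-- A fair division instance with `n` agents: `m` indivisible goods, `k` homogeneous divisible
goods, and the non-negative utility of every agent for every (whole) good. -/
structure Instance (n : ℕ) where
  m : ℕ
  k : ℕ
  uInd : Fin n → Fin m → ℝ
  uDiv : Fin n → Fin k → ℝ
  uInd_nonneg : ∀ i g, 0 ≤ uInd i g
  uDiv_nonneg : ∀ i d, 0 ≤ uDiv i d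

/-- A bundle: a set of indivisible goods and a fraction in `[0, 1]` of each divisible good. -/
structure Bundle (m k : ℕ) where
  goods : Finset (Fin m)
  frac : Fin k → ℝ
  frac_mem : ∀ d, frac d ∈ Set.Icc (0 : ℝ) 1

/-- The bundle with the indivisible good `g` removed. -/
def Bundle.remove {m k : ℕ} (B : Bundle m k) (g : Fin m) : Bundle m k where
  goods := B.goods.erase g
  frac := B.frac
  frac_mem := B.frac_mem

/-- The additive utility of agent `i` for a bundle. -/
noncomputable def Instance.utility {n : ℕ} (I : Instance n) (i : Fin n) (B : Bundle I.m I.k) : ℝ :=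
  ∑ g ∈ B.goods, I.uInd i g + ∑ d, B.frac d * I.uDiv i d

/-- The utility of agent `i` for the set of all goods. -/
noncomputable def Instance.total {n : ℕ} (I : Instance n) (i : Fin n) : ℝ :=
  ∑ g, I.uInd i g + ∑ d, I.uDiv i d

/-- A feasible, possibly partial, allocation. -/
structure Allocation {n : ℕ} (I : Instance n) where
  bundle : Fin n → Bundle I.m I.k
  disjoint : ∀ i j, i ≠ j → Disjoint (bundle i).goods (bundle j).goods
  sum_frac_le : ∀ d, ∑ i, (bundle i).frac d ≤ 1

/-- Every good is allocated in its entirety. -/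
def Allocation.IsComplete {n : ℕ} {I : Instance n} (A : Allocation I) : Prop :=
  (∀ g, ∃ i, g ∈ (A.bundle i).goods) ∧ ∀ d, ∑ i, (A.bundle i).frac d = 1

/-- Utilitarian social welfare. -/
noncomputable def Allocation.welfare {n : ℕ} {I : Instance n} (A : Allocation I) : ℝ :=
  ∑ i, I.utility i (A.bundle i)

/-- Envy-freeness up to one good (used for instances without divisible goods). -/
def EF1 {n : ℕ} (I : Instance n) (A : Allocation I) : Prop :=
  ∀ i j, (A.bundle j).goods.Nonempty →
    ∃ g ∈ (A.bundle j).goods,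
      I.utility i ((A.bundle j).remove g) ≤ I.utility i (A.bundle i)

/-- Envy-freeness for mixed goods. -/
def EFM {n : ℕ} (I : Instance n) (A : Allocation I) : Prop :=
  ∀ i j,
    ((A.bundle j).frac = 0 →
      I.utility i (A.bundle j) ≤ I.utility i (A.bundle i) ∨
        ∃ g ∈ (A.bundle j).goods,
          I.utility i ((A.bundle j).remove g) ≤ I.utility i (A.bundle i)) ∧
    ((A.bundle j).frac ≠ 0 → I.utility i (A.bundle j) ≤ I.utility i (A.bundle i))

/-- Envy-freeness up to any good for mixed goods. -/
def EFXM {n : ℕ} (I : Instance n) (A : Allocation I) : Prop :=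
  ∀ i j,
    ((A.bundle j).frac = 0 →
      I.utility i (A.bundle j) ≤ I.utility i (A.bundle i) ∨
        ∀ g ∈ (A.bundle j).goods,
          I.utility i ((A.bundle j).remove g) ≤ I.utility i (A.bundle i)) ∧
    ((A.bundle j).frac ≠ 0 → I.utility i (A.bundle j) ≤ I.utility i (A.bundle i))

/-- The largest social welfare of an allocation of `I` with property `P`. -/
noncomputable def bestWelfare {n : ℕ} (I : Instance n) (P : Allocation I → Prop) : ℝ≥0∞ :=
  ⨆ (A : Allocation I) (_ : P A), ENNReal.ofReal A.welfare

/-- The optimal social welfare of `I`. -/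
noncomputable def optWelfare {n : ℕ} (I : Instance n) : ℝ≥0∞ :=
  bestWelfare I fun _ => True

/-- The price of `P` for the instance `I`. In `ℝ≥0∞` this ratio is `∞` if only the denominator
vanishes; it is `0` if both vanish, so such trivial instances do not affect a supremum. -/
noncomputable def priceFor {n : ℕ} (I : Instance n) (P : Allocation I → Prop) : ℝ≥0∞ :=
  optWelfare I / bestWelfare I P

/-- The price of `P` over all instances with `n` agents and mixed goods (unscaled utilities). -/
noncomputable def price (P : ∀ {n : ℕ} (I : Instance n), Allocation I → Prop) (n : ℕ) : ℝ≥0∞ :=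
  ⨆ I : Instance n, priceFor I (P I)

/-- The price of `P` over all instances with `n` agents and only indivisible goods
(unscaled utilities). -/
noncomputable def priceIndivisible (P : ∀ {n : ℕ} (I : Instance n), Allocation I → Prop) (n : ℕ) :
    ℝ≥0∞ :=
  ⨆ (I : Instance n) (_ : I.k = 0), priceFor I (P I)

/-- `p` is of order exactly `n`, with one pair of constants for all `n ≥ 1`. -/
def IsThetaLinear (p : ℕ → ℝ≥0∞) : Prop :=
  ∃ c C : ℝ, 0 < c ∧ 0 < C ∧ ∀ n : ℕ, 1 ≤ n →
    ENNReal.ofReal (c * n) ≤ p n ∧ p n ≤ ENNReal.ofReal (C * n)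

end FairDivision

/-!
Write `T` for the sum over all agents of their values for all goods.

*Divisible goods.* Once the indivisible goods are split into bundles, the divisible goods can be
shared out completely so that nobody loses and nobody envies a bundle with a divisible part
(`exists_perm_divisible_shares`). Only distributions are needed that give a bundle the same fraction
of every divisible good, so that the divisible goods act as a single one. The proof replaces the
water-filling procedure by compactness: in a distribution of largest volume, and for it an
assignment of bundles of largest welfare, the graph of weak envy has a source component without
strict envy (`exists_improving_perm_or_unenvied_set`), whose bundles could receive more.
As no utility decreases, fairness up to removal of a good survives for the bundles without a
divisible part.

*Welfare.* Suppose that bundle `j` is not envied after the removal of a set `R j` of at most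
one good, the same for all agents. Summing over `j`, agent `i` gets at least `1 / n` of her value
for all goods, except for the removed goods (and unallocated goods, which count as one more bundle
when nobody envies them). The values of all agents for all removed goods sum to the welfare of the
`n` cyclic shifts of the allocation `R` (`sum_sum_le_of_matching_bound`). So they are at most
`n` times the welfare of the allocation as soon as this is at least the welfare of every
allocation of at most one good per agent, and then `T` is at most `2 * n`, respectively `2 * n + 1`,
times the welfare (`exists_allocation_sum_total_le`).

*Indivisible goods.* A partial EFX allocation of maximal welfare leaves an unenvied rest
(`exists_efx_pool_unenvied`), which gives the EFXM allocation. For the complete EFM allocation, an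
optimal allocation of at most one good per agent is extended by envy cycle elimination
(`exists_complete_uniform_ef1`).

*Prices.* As the optimal welfare is at most `T`, the upper bounds follow. For the lower bounds,
let `n` goods have value `1` for one agent and `1 / n` for the others. The optimal welfare
is at least `n`, but in an EF1 allocation the first agent gets at most one good, and the welfare is
at most `2`. EFXM implies EFM, which implies EF1.
-/

namespace FairDivision

open Finset Relation

/-! ### Envy graphs -/

theorem exists_nodup_isChain_of_reflTransGen {α : Type*} {r : α → α → Prop} {a b : α}
    (h : ReflTransGen r a b) :
    ∃ l : List α, (a :: l).Nodup ∧ (a :: l).IsChain r ∧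
      (a :: l).getLast (List.cons_ne_nil a l) = b := by
  classical
  induction h using ReflTransGen.head_induction_on with
  | refl => exact ⟨[], by simp, by simp, by simp⟩
  | @head a c hac _ ih =>
    obtain ⟨l, hnd, hch, hlast⟩ := ih
    by_cases ha : a ∈ c :: l
    · obtain ⟨s, t, hst⟩ := List.append_of_mem ha
      refine ⟨t, ?_, ?_, ?_⟩
      · rw [hst] at hnd
        exact (List.nodup_append.mp hnd).2.1
      · rw [hst] at hch
        exact hch.right_of_append
      · rw [← hlast]
        simp only [hst]
        rw [List.getLast_append_of_ne_nil]
    · refine ⟨c :: l, List.nodup_cons.mpr ⟨ha, hnd⟩, ?_, ?_⟩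
      · exact List.isChain_cons_cons.mpr ⟨hac, hch⟩
      · rw [List.getLast_cons (List.cons_ne_nil c l)]
        exact hlast

/-- Closing a path from `a` to `b` by an additional arrow from `b` to `a` yields a permutation
that, except at `b`, moves along the arrows of the reflexive relation `r`. -/
theorem exists_perm_of_reflTransGen {α : Type*} {r : α → α → Prop} (hr : ∀ x, r x x) {a b : α}
    (h : ReflTransGen r a b) :
    ∃ σ : Equiv.Perm α, σ b = a ∧ ∀ x, x ≠ b → r x (σ x) := by
  classical
  obtain ⟨l, hnd, hch, hlast⟩ := exists_nodup_isChain_of_reflTransGen h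
  refine ⟨(a :: l).formPerm, ?_, fun x hx => ?_⟩
  · rw [← hlast, List.formPerm_apply_getLast]
  · by_cases hxl : x ∈ a :: l
    · obtain ⟨i, hi, rfl⟩ := List.getElem_of_mem hxl
      have hi' : i + 1 < (a :: l).length := by
        by_contra hcon
        apply hx
        rw [← hlast, List.getLast_eq_getElem]
        congr 1
        omega
      rw [List.formPerm_apply_lt_getElem _ hnd _ hi']
      exact (List.isChain_iff_getElem.mp hch) i hi'
    · rw [List.formPerm_apply_of_notMem hxl]
      exact hr x

/-- Here `a i j` is the value of agent `i` for the bundle of agent `j`. Either the bundles can be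
permuted in a way that harms no agent and benefits one, or there is a nonempty set `S` of agents
whom nobody envies, and whose bundles every agent outside `S` values strictly less than her own.
Such a set `S` is a source component of the graph of weak envy: a strict envy inside a strongly
connected component lies on a cycle, along which the bundles could be passed on. -/
theorem exists_improving_perm_or_unenvied_set {V : Type*} [Finite V] [Nonempty V]
    (a : V → V → ℝ) :
    (∃ σ : Equiv.Perm V, (∀ i, a i i ≤ a i (σ i)) ∧ ∃ i, a i i < a i (σ i)) ∨
    ∃ S : Set V, S.Nonempty ∧ (∀ i, ∀ j ∈ S, a i j ≤ a i i) ∧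
      ∀ i, i ∉ S → ∀ j ∈ S, a i j < a i i := by
  let r : V → V → Prop := fun i j => a i i ≤ a i j
  let P : Preorder V :=
    { le := ReflTransGen r
      le_refl := fun _ => ReflTransGen.refl
      le_trans := fun _ _ _ => ReflTransGen.trans }
  obtain ⟨i₀, -, hi₀⟩ := Set.finite_univ.exists_minimal (α := V) Set.univ_nonempty
  have hmin : ∀ i, ReflTransGen r i i₀ → ReflTransGen r i₀ i := fun i hi =>
    hi₀ (Set.mem_univ i) hi
  refine or_iff_not_imp_left.mpr fun hno => ⟨{i | ReflTransGen r i i₀}, ⟨i₀, .refl⟩, ?_, ?_⟩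
  · intro i j hj
    by_contra! hlt
    apply hno
    -- The path from `j` through `i₀` back to `i` closes the strict envy of `i` to a cycle.
    have hi : ReflTransGen r i i₀ := ReflTransGen.head hlt.le hj
    obtain ⟨σ, hσ, hσ'⟩ := exists_perm_of_reflTransGen (r := r) (fun _ => le_refl _)
      (ReflTransGen.trans hj (hmin i hi))
    refine ⟨σ, fun k => ?_, i, by rwa [hσ]⟩
    by_cases hk : k = i
    · subst hk
      rw [hσ]
      exact hlt.le
    · exact hσ' k hk
  · intro i hi j hj
    by_contra! hle
    exact hi (ReflTransGen.head hle hj)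

/-! ### Distribution of the divisible goods -/

/-- Here `w i j` is the value of agent `i` for the indivisible goods in bundle `j`, bundle `j`
is given to agent `j` at first, and `c i` is the value of agent `i` for the whole of the
divisible goods. The divisible goods can be distributed completely, a fraction `t j` of each of
them going to bundle `j`, and the bundles can then be given to the agents in the order `σ`, so that
nobody loses and nobody envies a bundle with divisible goods. The vector `t` with the
largest sum works: with an assignment of maximal welfare for it, if the sum were less than `1`, a
little of the divisible goods could be added to each bundle of an unenvied set. -/
theorem exists_perm_divisible_shares {V : Type*} [Fintype V] [Nonempty V] (w : V → V → ℝ)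
    (c : V → ℝ) (hc : ∀ i, 0 ≤ c i) :
    ∃ (σ : Equiv.Perm V) (t : V → ℝ), (∀ j, 0 ≤ t j) ∧ ∑ j, t j = 1 ∧
      (∀ i, w i i ≤ w i (σ i) + t (σ i) * c i) ∧
      ∀ j, t j ≠ 0 → ∀ i, w i j + t j * c i ≤ w i (σ i) + t (σ i) * c i := by
  classical
  let X : Equiv.Perm V → Set (V → ℝ) := fun σ =>
    {t | (∀ j, 0 ≤ t j) ∧ ∑ j, t j ≤ 1 ∧ (∀ i, w i i ≤ w i (σ i) + t (σ i) * c i) ∧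
      ∀ j, t j = 0 ∨ ∀ i, w i j + t j * c i ≤ w i (σ i) + t (σ i) * c i}
  have hcompact : ∀ σ, IsCompact (X σ) := by
    intro σ
    have hsub : X σ ⊆ Set.pi Set.univ fun _ => Set.Icc (0 : ℝ) 1 := by
      rintro t ⟨h0, h1, -, -⟩ j -
      exact ⟨h0 j, (single_le_sum (fun i _ => h0 i) (mem_univ j)).trans h1⟩
    refine (isCompact_univ_pi fun _ => isCompact_Icc).of_isClosed_subset ?_ hsub
    have hX : X σ = (⋂ j, {t | 0 ≤ t j}) ∩ ({t | ∑ j, t j ≤ 1} ∩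
        ((⋂ i, {t | w i i ≤ w i (σ i) + t (σ i) * c i}) ∩
          ⋂ j, ({t | t j = 0} ∪ ⋂ i, {t | w i j + t j * c i ≤ w i (σ i) + t (σ i) * c i}))) := by
      ext t
      simp [X]
    rw [hX]
    refine IsClosed.inter ?_ (IsClosed.inter ?_ (IsClosed.inter ?_ ?_))
    · exact isClosed_iInter fun j => isClosed_le (by fun_prop) (by fun_prop)
    · exact isClosed_le (by fun_prop) (by fun_prop)
    · exact isClosed_iInter fun j => isClosed_le (by fun_prop) (by fun_prop)
    · exact isClosed_iInter fun j => (isClosed_eq (by fun_prop) (by fun_prop)).union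
        (isClosed_iInter fun i => isClosed_le (by fun_prop) (by fun_prop))
  have hne : (⋃ σ, X σ).Nonempty :=
    ⟨0, Set.mem_iUnion.mpr ⟨1, by simp, by simp, by simp, by simp⟩⟩
  obtain ⟨t, htX, htmax⟩ := (isCompact_iUnion hcompact).exists_isMaxOn hne
    (f := fun t : V → ℝ => ∑ j, t j) (by fun_prop)
  obtain ⟨σ₀, hσ₀⟩ := Set.mem_iUnion.mp htX
  obtain ⟨σ, hσ, hσmax⟩ := exists_max_image (univ.filter fun σ => t ∈ X σ)
    (fun σ => ∑ i, (w i (σ i) + t (σ i) * c i)) ⟨σ₀, by simpa using hσ₀⟩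
  obtain ⟨h0, h1, hw, hne⟩ : t ∈ X σ := by simpa using hσ
  refine ⟨σ, t, h0, ?_, hw, fun j hj => (hne j).resolve_left hj⟩
  by_contra hsum
  have hlt : ∑ j, t j < 1 := lt_of_le_of_ne h1 hsum
  rcases exists_improving_perm_or_unenvied_set fun i j => w i (σ j) + t (σ j) * c i with
    ⟨τ, hτ, i₀, hi₀⟩ | ⟨S, hSne, hS, hS'⟩
  · have hτX : t ∈ X (τ.trans σ) :=
      ⟨h0, h1, fun i => (hw i).trans (hτ i),
        fun j => (hne j).imp id fun h i => (h i).trans (hτ i)⟩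
    refine absurd (hσmax (τ.trans σ) (by simpa using hτX)) (not_le.mpr ?_)
    exact sum_lt_sum (fun i _ => hτ i) ⟨i₀, mem_univ _, hi₀⟩
  · -- `ε` is small against the unallocated rest and against the strict preferences over `S`.
    have hev : ∀ᶠ ε : ℝ in nhdsWithin 0 (Set.Ioi 0), ∑ j, t j + Fintype.card V * ε ≤ 1 ∧
        ∀ i, i ∉ S → ∀ j, j ∈ S → w i (σ j) + (t (σ j) + ε) * c i ≤ w i (σ i) + t (σ i) * c i := by
      refine Filter.Eventually.filter_mono nhdsWithin_le_nhds ?_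
      refine Filter.Eventually.and ?_ ?_
      · have hcont : Continuous fun ε : ℝ => ∑ j, t j + Fintype.card V * ε := by fun_prop
        have := hcont.tendsto 0
        exact (this.eventually_lt_const (by simpa using hlt)).mono fun _ h => h.le
      · refine Filter.eventually_all.mpr fun i => ?_
        by_cases hi : i ∈ S
        · simp [hi]
        refine Filter.Eventually.mono (Filter.eventually_all.mpr fun j => ?_) fun _ h _ => h
        by_cases hj : j ∈ S
        · have hcont : Continuous fun ε : ℝ => w i (σ j) + (t (σ j) + ε) * c i := by fun_prop
          have := hcont.tendsto 0
          exact (this.eventually_lt_const (by simpa using hS' i hi j hj)).mono fun _ h _ => h.le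
        · simp [hj]
    obtain ⟨ε, ⟨hε1, hε2⟩, hεpos⟩ := (hev.and self_mem_nhdsWithin).exists
    replace hεpos : 0 < ε := hεpos
    let t' : V → ℝ := fun j => t j + if σ.symm j ∈ S then ε else 0
    have ht' : ∀ i, t' (σ i) = t (σ i) + if i ∈ S then ε else 0 := fun i => by simp [t']
    have hge : ∀ j, t j ≤ t' j := fun j => by
      simp only [t']; split_ifs <;> linarith
    have hmono : ∀ i, w i (σ i) + t (σ i) * c i ≤ w i (σ i) + t' (σ i) * c i := fun i => by
      have := mul_le_mul_of_nonneg_right (hge (σ i)) (hc i)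
      linarith
    have ht'X : t' ∈ X σ := by
      refine ⟨fun j => (h0 j).trans (hge j), ?_, fun i => (hw i).trans (hmono i), fun j => ?_⟩
      · refine le_trans ?_ hε1
        simp only [t', sum_add_distrib]
        gcongr
        calc ∑ j, (if σ.symm j ∈ S then ε else 0) ≤ ∑ _j : V, ε :=
              sum_le_sum fun j _ => by split_ifs <;> linarith
          _ = Fintype.card V * ε := by simp
      · by_cases hj : σ.symm j ∈ S
        · right
          intro i
          obtain ⟨j, rfl⟩ := σ.surjective j
          rw [Equiv.symm_apply_apply] at hj
          by_cases hi : i ∈ S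
          · rw [ht', ht', if_pos hi, if_pos hj]
            have := hS i j hj
            linarith
          · have := hε2 i hi j hj
            rw [ht', ht', if_neg hi, if_pos hj, add_zero]
            exact this
        · have htj : t' j = t j := by simp [t', hj]
          rw [htj]
          exact (hne j).imp id fun h i => (h i).trans (hmono i)
    refine absurd (isMaxOn_iff.mp htmax t' (Set.mem_iUnion.mpr ⟨σ, ht'X⟩)) (not_le.mpr ?_)
    obtain ⟨j, hj⟩ := hSne
    exact sum_lt_sum (fun j _ => hge j) ⟨σ j, mem_univ _, by simp [ht', hj, hεpos]⟩

/-! ### Distribution of the indivisible goods -/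

section Indivisible

variable {V G : Type*} [Fintype V] [Fintype G] [DecidableEq G]

/-- There is a partial EFX allocation such that no agent prefers the set of unallocated goods to
her bundle, and whose welfare is at least that of every allocation of at most one good per agent.
An EFX allocation of maximal welfare works: if an agent preferred the set of unallocated goods, a
minimal set of unallocated goods that some agent prefers to her bundle could be given to that agent
in exchange for her bundle, and minimality keeps the allocation EFX. -/
theorem exists_efx_pool_unenvied (u : V → G → ℝ) (hu : ∀ i g, 0 ≤ u i g) :
    ∃ M : V → Finset G, Pairwise (fun i j => Disjoint (M i) (M j)) ∧
      (∀ i j, ∀ g ∈ M j, ∑ x ∈ (M j).erase g, u i x ≤ ∑ x ∈ M i, u i x) ∧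
      (∀ i, ∑ x ∈ univ \ univ.biUnion M, u i x ≤ ∑ x ∈ M i, u i x) ∧
      ∀ N : V → Finset G, Pairwise (fun i j => Disjoint (N i) (N j)) → (∀ i, #(N i) ≤ 1) →
        ∑ i, ∑ x ∈ N i, u i x ≤ ∑ i, ∑ x ∈ M i, u i x := by
  classical
  let F : Finset (V → Finset G) := univ.filter fun M =>
    Pairwise (fun i j => Disjoint (M i) (M j)) ∧
      ∀ i j, ∀ g ∈ M j, ∑ x ∈ (M j).erase g, u i x ≤ ∑ x ∈ M i, u i x
  obtain ⟨M, hM, hmax⟩ := exists_max_image F (fun M => ∑ i, ∑ x ∈ M i, u i x)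
    ⟨fun _ => ∅, mem_filter.mpr ⟨mem_univ _, by simp [Pairwise]⟩⟩
  obtain ⟨hdisj, hefx⟩ := (mem_filter.mp hM).2
  refine ⟨M, hdisj, hefx, ?_, fun N hN hN1 => hmax N ?_⟩
  · by_contra! hcon
    obtain ⟨i₁, hi₁⟩ := hcon
    obtain ⟨Z, hZ, hZmin⟩ := exists_min_image
      ((univ \ univ.biUnion M).powerset.filter fun Z => ∃ i, ∑ x ∈ M i, u i x < ∑ x ∈ Z, u i x)
      card ⟨_, mem_filter.mpr ⟨mem_powerset_self _, i₁, hi₁⟩⟩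
    obtain ⟨hZsub, i, hi⟩ := mem_filter.mp hZ
    rw [mem_powerset] at hZsub
    have hZM : ∀ j, Disjoint (M j) Z := fun j => by
      rw [disjoint_left]
      intro x hx hxZ
      exact (mem_sdiff.mp (hZsub hxZ)).2 (mem_biUnion.mpr ⟨j, mem_univ _, hx⟩)
    let M' := Function.update M i Z
    have hself : M' i = Z := Function.update_self ..
    have hother : ∀ j, j ≠ i → M' j = M j := fun j hj => Function.update_of_ne hj ..
    have hle : ∀ k, ∑ x ∈ M k, u k x ≤ ∑ x ∈ M' k, u k x := fun k => by
      by_cases hk : k = i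
      · subst hk
        rw [hself]
        exact hi.le
      · rw [hother k hk]
    refine absurd (hmax M' (mem_filter.mpr ⟨mem_univ _, ?_, ?_⟩)) (not_le.mpr ?_)
    · intro k l hkl
      by_cases hk : k = i
      · subst hk
        rw [hself, hother l hkl.symm]
        exact (hZM l).symm
      · by_cases hl : l = i
        · subst hl
          rw [hself, hother k hk]
          exact hZM k
        · rw [hother k hk, hother l hl]
          exact hdisj hkl
    · intro k j g hg
      refine le_trans ?_ (hle k)
      by_cases hj : j = i
      · subst hj
        rw [hself] at hg ⊢
        by_contra! hlt
        have := hZmin (Z.erase g) (mem_filter.mpr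
          ⟨mem_powerset.mpr ((erase_subset _ _).trans hZsub), k, hlt⟩)
        have := card_erase_lt_of_mem hg
        omega
      · rw [hother j hj] at hg ⊢
        exact hefx k j g hg
    · exact sum_lt_sum (fun k _ => hle k) ⟨i, mem_univ _, by rwa [hself]⟩
  · refine mem_filter.mpr ⟨mem_univ _, hN, fun i j g hg => ?_⟩
    have : (N j).erase g = ∅ := by
      rw [← card_eq_zero, card_erase_of_mem hg]
      have := hN1 j
      omega
    rw [this, sum_empty]
    exact sum_nonneg fun x _ => hu i x

/-- Every allocation `N` of at most one good per agent can be developed into a complete allocation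
`M` of no smaller welfare that is EF1 in a uniform way: no agent envies bundle `j` after the removal
of a set `R j` of at most one good, which is the same for all agents. An allocation of this kind
that is maximal, first in the number of allocated goods and then in welfare, works. -/
theorem exists_complete_uniform_ef1 [Nonempty V] (u : V → G → ℝ) (hu : ∀ i g, 0 ≤ u i g)
    (N : V → Finset G) (hN : Pairwise fun i j => Disjoint (N i) (N j)) (hN1 : ∀ i, #(N i) ≤ 1) :
    ∃ M R : V → Finset G, Pairwise (fun i j => Disjoint (M i) (M j)) ∧
      univ.biUnion M = univ ∧ (∀ j, R j ⊆ M j) ∧ (∀ j, #(R j) ≤ 1) ∧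
      (∀ i j, ∑ x ∈ M j \ R j, u i x ≤ ∑ x ∈ M i, u i x) ∧
      ∑ i, ∑ x ∈ N i, u i x ≤ ∑ i, ∑ x ∈ M i, u i x := by
  classical
  let F : Finset ((V → Finset G) × (V → Finset G)) := univ.filter fun p =>
    Pairwise (fun i j => Disjoint (p.1 i) (p.1 j)) ∧ (∀ j, p.2 j ⊆ p.1 j) ∧ (∀ j, #(p.2 j) ≤ 1) ∧
      (∀ i j, ∑ x ∈ p.1 j \ p.2 j, u i x ≤ ∑ x ∈ p.1 i, u i x) ∧
      ∑ i, ∑ x ∈ N i, u i x ≤ ∑ i, ∑ x ∈ p.1 i, u i x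
  obtain ⟨⟨M, R⟩, hMR, hmax⟩ := exists_max_image F
    (fun p => toLex (#(univ.biUnion p.1), ∑ i, ∑ x ∈ p.1 i, u i x))
    ⟨(N, N), mem_filter.mpr ⟨mem_univ _, hN, fun _ => Subset.rfl, hN1,
      fun i j => by simpa using sum_nonneg fun x _ => hu i x, le_rfl⟩⟩
  obtain ⟨hdisj, hsub, hR1, hef, hwel⟩ := (mem_filter.mp hMR).2
  refine ⟨M, R, hdisj, ?_, hsub, hR1, hef, hwel⟩
  by_contra hcompl
  obtain ⟨g, hg⟩ : ∃ g, g ∉ univ.biUnion M := by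
    by_contra! h
    exact hcompl (eq_univ_iff_forall.mpr h)
  have hgM : ∀ j, g ∉ M j := fun j hj => hg (mem_biUnion.mpr ⟨j, mem_univ _, hj⟩)
  rcases exists_improving_perm_or_unenvied_set fun i j => ∑ x ∈ M j, u i x with
    ⟨τ, hτ, i₀, hi₀⟩ | ⟨S, ⟨j, hj⟩, hS, -⟩
  · have hlt : ∑ i, ∑ x ∈ M i, u i x < ∑ i, ∑ x ∈ M (τ i), u i x :=
      sum_lt_sum (fun i _ => hτ i) ⟨i₀, mem_univ _, hi₀⟩
    have hmem : (M ∘ τ, R ∘ τ) ∈ F := mem_filter.mpr ⟨mem_univ _,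
      fun i j hij => hdisj (τ.injective.ne hij), fun j => hsub _, fun j => hR1 _,
      fun i j => (hef i (τ j)).trans (hτ i), hwel.trans hlt.le⟩
    refine absurd (hmax _ hmem) (not_le.mpr ?_)
    have hU : univ.biUnion (M ∘ τ) = univ.biUnion M := by
      ext x
      simp only [mem_biUnion, mem_univ, true_and, Function.comp_apply]
      exact (τ.surjective.exists (p := fun j => x ∈ M j)).symm
    rw [Prod.Lex.toLex_lt_toLex]
    exact Or.inr ⟨by simp only [hU], hlt⟩
  · -- The unenvied bundle `j` receives `g`, whose removal restores the former bundle.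
    let M' := Function.update M j (insert g (M j))
    let R' := Function.update R j {g}
    have hMself : M' j = insert g (M j) := Function.update_self ..
    have hMother : ∀ k, k ≠ j → M' k = M k := fun k hk => Function.update_of_ne hk ..
    have hRself : R' j = {g} := Function.update_self ..
    have hRother : ∀ k, k ≠ j → R' k = R k := fun k hk => Function.update_of_ne hk ..
    have hle : ∀ k, ∑ x ∈ M k, u k x ≤ ∑ x ∈ M' k, u k x := fun k => by
      by_cases hk : k = j
      · subst hk
        rw [hMself]
        exact sum_le_sum_of_subset_of_nonneg (subset_insert _ _) fun x _ _ => hu k x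
      · rw [hMother k hk]
    have hmem : (M', R') ∈ F := by
      refine mem_filter.mpr ⟨mem_univ _, ?_, fun k => ?_, fun k => ?_, fun i k => ?_,
        hwel.trans (sum_le_sum fun k _ => hle k)⟩
      · intro k l hkl
        by_cases hk : k = j
        · subst hk
          simp only [hMself, hMother l hkl.symm]
          exact disjoint_insert_left.mpr ⟨hgM l, hdisj hkl⟩
        · by_cases hl : l = j
          · subst hl
            simp only [hMself, hMother k hk]
            exact disjoint_insert_right.mpr ⟨hgM k, hdisj hkl⟩
          · simp only [hMother k hk, hMother l hl]
            exact hdisj hkl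
      · by_cases hk : k = j
        · subst hk
          simp only [hMself, hRself, singleton_subset_iff, mem_insert_self]
        · simp only [hMother k hk, hRother k hk, hsub k]
      · by_cases hk : k = j
        · subst hk
          simp only [hRself, card_singleton, le_refl]
        · simp only [hRother k hk, hR1 k]
      · refine le_trans ?_ (hle i)
        by_cases hk : k = j
        · subst hk
          have : insert g (M k) \ {g} = M k := by
            rw [sdiff_singleton_eq_erase, erase_insert (hgM k)]
          simp only [hMself, hRself, this]
          exact hS i k hj
        · simp only [hMother k hk, hRother k hk]
          exact hef i k
    refine absurd (hmax _ hmem) (not_le.mpr ?_)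
    rw [Prod.Lex.toLex_lt_toLex]
    refine Or.inl (card_lt_card (ssubset_iff_of_subset ?_ |>.mpr ⟨g, ?_, hg⟩))
    · refine biUnion_mono fun k _ => ?_
      change M k ⊆ M' k
      by_cases hk : k = j
      · subst hk
        rw [hMself]
        exact subset_insert _ _
      · rw [hMother k hk]
    · refine mem_biUnion.mpr ⟨j, mem_univ _, ?_⟩
      change g ∈ M' j
      rw [hMself]
      exact mem_insert_self _ _

end Indivisible

/-- If `B` bounds the welfare of all allocations of at most one good per agent, then it bounds the
welfare of each of the `n` cyclic shifts of such an allocation `R`, and in these together every agent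
gets every bundle once. -/
theorem sum_sum_le_of_matching_bound {n : ℕ} [NeZero n] {G : Type*} (u : Fin n → G → ℝ) (B : ℝ)
    (hB : ∀ N : Fin n → Finset G, Pairwise (fun i j => Disjoint (N i) (N j)) → (∀ i, #(N i) ≤ 1) →
      ∑ i, ∑ x ∈ N i, u i x ≤ B)
    (R : Fin n → Finset G) (hR : Pairwise fun i j => Disjoint (R i) (R j)) (hR1 : ∀ i, #(R i) ≤ 1) :
    ∑ i, ∑ j, ∑ x ∈ R j, u i x ≤ n * B := by
  calc ∑ i, ∑ j, ∑ x ∈ R j, u i x = ∑ i, ∑ s, ∑ x ∈ R (i + s), u i x :=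
        sum_congr rfl fun i _ =>
          (Equiv.sum_comp (Equiv.addLeft i) fun j => ∑ x ∈ R j, u i x).symm
    _ = ∑ s, ∑ i, ∑ x ∈ R (i + s), u i x := sum_comm
    _ ≤ ∑ _s : Fin n, B := sum_le_sum fun s _ =>
        hB (fun i => R (i + s)) (fun _ _ hij => hR ((add_left_injective s).ne hij)) fun _ => hR1 _
    _ = n * B := by simp

/-! ### Mixed goods -/

theorem Instance.utility_nonneg {n : ℕ} (I : Instance n) (i : Fin n) (B : Bundle I.m I.k) :
    0 ≤ I.utility i B :=
  add_nonneg (sum_nonneg fun g _ => I.uInd_nonneg i g)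
    (sum_nonneg fun d _ => mul_nonneg (B.frac_mem d).1 (I.uDiv_nonneg i d))

theorem Instance.utility_remove_le {n : ℕ} (I : Instance n) (i : Fin n) (B : Bundle I.m I.k)
    (g : Fin I.m) : I.utility i (B.remove g) ≤ I.utility i B :=
  add_le_add (sum_le_sum_of_subset_of_nonneg (erase_subset _ _) fun x _ _ => I.uInd_nonneg i x)
    le_rfl

theorem Instance.utility_eq_of_frac_eq_zero {n : ℕ} (I : Instance n) (i : Fin n)
    {B : Bundle I.m I.k} (hB : B.frac = 0) : I.utility i B = ∑ g ∈ B.goods, I.uInd i g := by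
  simp [Instance.utility, hB]

theorem Allocation.sum_utility {n : ℕ} {I : Instance n} (A : Allocation I) (i : Fin n) :
    ∑ j, I.utility i (A.bundle j) =
      ∑ g ∈ univ.biUnion fun j => (A.bundle j).goods, I.uInd i g +
        ∑ d, (∑ j, (A.bundle j).frac d) * I.uDiv i d := by
  simp only [Instance.utility, sum_add_distrib]
  rw [sum_biUnion fun j _ k _ hjk => A.disjoint j k hjk, sum_comm (s := univ) (t := univ)]
  simp only [sum_mul]

theorem Allocation.welfare_le_sum_total {n : ℕ} {I : Instance n} (A : Allocation I) :
    A.welfare ≤ ∑ i, I.total i := by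
  refine sum_le_sum fun i _ => ?_
  calc I.utility i (A.bundle i) ≤ ∑ j, I.utility i (A.bundle j) :=
        single_le_sum (fun j _ => I.utility_nonneg i _) (mem_univ i)
    _ ≤ I.total i := by
        rw [A.sum_utility]
        refine add_le_add (sum_le_sum_of_subset_of_nonneg (subset_univ _)
          fun x _ _ => I.uInd_nonneg i x) (sum_le_sum fun d _ => ?_)
        exact mul_le_of_le_one_left (I.uDiv_nonneg i d) (A.sum_frac_le d)

/-- An allocation `M` of indivisible goods can be completed by the divisible goods, up to the order
of the bundles, so that nobody loses and nobody envies a bundle with divisible goods. -/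
theorem exists_allocation_of_disjoint {n : ℕ} [NeZero n] (I : Instance n)
    (M : Fin n → Finset (Fin I.m)) (hM : Pairwise fun i j => Disjoint (M i) (M j)) :
    ∃ (σ : Equiv.Perm (Fin n)) (A : Allocation I), (∀ i, (A.bundle i).goods = M (σ i)) ∧
      (∀ d, ∑ i, (A.bundle i).frac d = 1) ∧
      (∀ i, ∑ g ∈ M i, I.uInd i g ≤ I.utility i (A.bundle i)) ∧
      ∀ j, (A.bundle j).frac = 0 ∨ ∀ i, I.utility i (A.bundle j) ≤ I.utility i (A.bundle i) := by
  obtain ⟨σ, t, h0, h1, hw, hne⟩ := exists_perm_divisible_shares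
    (fun i j => ∑ g ∈ M j, I.uInd i g) (fun i => ∑ d, I.uDiv i d)
    fun i => sum_nonneg fun d _ => I.uDiv_nonneg i d
  have hsum : ∑ i, t (σ i) = 1 := by rw [Equiv.sum_comp σ t, h1]
  let A : Allocation I :=
    { bundle := fun i =>
        { goods := M (σ i)
          frac := fun _ => t (σ i)
          frac_mem := fun _ => ⟨h0 _, h1 ▸ single_le_sum (fun j _ => h0 j) (mem_univ (σ i))⟩ }
      disjoint := fun i j hij => hM (σ.injective.ne hij)
      sum_frac_le := fun _ => hsum.le }
  have hA : ∀ i j, I.utility i (A.bundle j) =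
      ∑ g ∈ M (σ j), I.uInd i g + t (σ j) * ∑ d, I.uDiv i d := fun i j => by
    rw [mul_sum]
    rfl
  refine ⟨σ, A, fun _ => rfl, fun _ => hsum, fun i => ?_, fun j => ?_⟩
  · rw [hA]
    exact hw i
  · by_cases hj : t (σ j) = 0
    · exact Or.inl (funext fun _ => hj)
    · refine Or.inr fun i => ?_
      rw [hA, hA]
      exact hne _ hj i

/-- Let `M` be an allocation of indivisible goods in which no agent envies bundle `j` after the
removal of the set `R j` of at most one good, each agent values the unallocated goods at most
`δ` times as much as her bundle, and the welfare is at least that of every allocation of at most one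
good per agent. By the first two properties, `n + δ` times the utility of an agent
is at least her value for everything except the removed goods, and by the last one these removed
goods cost at most `n` times the welfare in total. -/
theorem exists_allocation_sum_total_le {n : ℕ} [NeZero n] (I : Instance n)
    (M R : Fin n → Finset (Fin I.m)) (hM : Pairwise fun i j => Disjoint (M i) (M j))
    (hR : ∀ j, R j ⊆ M j) (hR1 : ∀ j, #(R j) ≤ 1)
    (hef : ∀ i j, ∑ g ∈ M j \ R j, I.uInd i g ≤ ∑ g ∈ M i, I.uInd i g) {δ : ℝ} (hδ : 0 ≤ δ)
    (hpool : ∀ i, ∑ g ∈ univ \ univ.biUnion M, I.uInd i g ≤ δ * ∑ g ∈ M i, I.uInd i g)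
    (hmatch : ∀ N : Fin n → Finset (Fin I.m), Pairwise (fun i j => Disjoint (N i) (N j)) →
      (∀ i, #(N i) ≤ 1) → ∑ i, ∑ g ∈ N i, I.uInd i g ≤ ∑ i, ∑ g ∈ M i, I.uInd i g) :
    ∃ (σ : Equiv.Perm (Fin n)) (A : Allocation I), (∀ i, (A.bundle i).goods = M (σ i)) ∧
      (∀ d, ∑ i, (A.bundle i).frac d = 1) ∧
      (∀ i, ∑ g ∈ M i, I.uInd i g ≤ I.utility i (A.bundle i)) ∧
      (∀ j, (A.bundle j).frac = 0 ∨ ∀ i, I.utility i (A.bundle j) ≤ I.utility i (A.bundle i)) ∧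
      ∑ i, I.total i ≤ (2 * n + δ) * A.welfare := by
  obtain ⟨σ, A, hgoods, hfrac, hge, hne⟩ := exists_allocation_of_disjoint I M hM
  refine ⟨σ, A, hgoods, hfrac, hge, hne, ?_⟩
  have hbundle : ∀ i j, I.utility i (A.bundle j) ≤
      I.utility i (A.bundle i) + ∑ g ∈ R (σ j), I.uInd i g := fun i j => by
    rcases hne j with hj | hj
    · rw [I.utility_eq_of_frac_eq_zero i hj, hgoods, ← sum_sdiff (hR (σ j))]
      gcongr
      exact (hef i (σ j)).trans (hge i)
    · exact (hj i).trans (le_add_of_nonneg_right (sum_nonneg fun g _ => I.uInd_nonneg i g))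
  have hU : (univ.biUnion fun j => (A.bundle j).goods) = univ.biUnion M := by
    ext x
    simp only [mem_biUnion, mem_univ, true_and, hgoods]
    exact (σ.surjective.exists (p := fun j => x ∈ M j)).symm
  have htotal : ∀ i, I.total i ≤
      (n + δ) * I.utility i (A.bundle i) + ∑ j, ∑ g ∈ R j, I.uInd i g := fun i => by
    have hsplit : I.total i = ∑ g ∈ univ \ univ.biUnion M, I.uInd i g +
        ∑ j, I.utility i (A.bundle j) := by
      rw [A.sum_utility, hU, ← add_assoc, sum_sdiff (subset_univ _)]
      simp [hfrac, Instance.total]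
    have h1 : ∑ j, I.utility i (A.bundle j) ≤
        n * I.utility i (A.bundle i) + ∑ j, ∑ g ∈ R j, I.uInd i g := by
      refine (sum_le_sum fun j _ => hbundle i j).trans_eq ?_
      rw [sum_add_distrib, Equiv.sum_comp σ fun j => ∑ g ∈ R j, I.uInd i g]
      simp
    have h2 := (hpool i).trans (mul_le_mul_of_nonneg_left (hge i) hδ)
    linarith
  have hremoved := sum_sum_le_of_matching_bound I.uInd _ hmatch R
    (fun i j hij => (hM hij).mono (hR i) (hR j)) hR1
  have hwel : ∑ i, ∑ g ∈ M i, I.uInd i g ≤ A.welfare := sum_le_sum fun i _ => hge i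
  calc ∑ i, I.total i ≤
        ∑ i, ((n + δ) * I.utility i (A.bundle i) + ∑ j, ∑ g ∈ R j, I.uInd i g) :=
        sum_le_sum fun i _ => htotal i
    _ = (n + δ) * A.welfare + ∑ i, ∑ j, ∑ g ∈ R j, I.uInd i g := by
        rw [sum_add_distrib, ← mul_sum]
        rfl
    _ ≤ (n + δ) * A.welfare + n * A.welfare := by
        gcongr
        exact hremoved.trans (by gcongr)
    _ = (2 * n + δ) * A.welfare := by ring

theorem exists_EFXM_sum_total_le {n : ℕ} (hn : 1 ≤ n) (I : Instance n) :
    ∃ A : Allocation I, EFXM I A ∧ (∑ i, I.total i) / (2 * n + 1) ≤ A.welfare := by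
  have : NeZero n := ⟨by omega⟩
  obtain ⟨M, hM, hefx, hpool, hmatch⟩ := exists_efx_pool_unenvied I.uInd I.uInd_nonneg
  -- In an EFX allocation, any good of a bundle can serve as the one to be removed.
  have hR : ∀ j, ∃ R, R ⊆ M j ∧ #R ≤ 1 ∧
      ∀ i, ∑ g ∈ M j \ R, I.uInd i g ≤ ∑ g ∈ M i, I.uInd i g := fun j => by
    rcases (M j).eq_empty_or_nonempty with hj | ⟨g, hg⟩
    · exact ⟨∅, by simp, by simp, fun i => by
        simpa [hj] using sum_nonneg fun g _ => I.uInd_nonneg i g⟩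
    · exact ⟨{g}, by simpa using hg, by simp, fun i => by
        simpa [sdiff_singleton_eq_erase] using hefx i j g hg⟩
  choose R hRM hR1 hef using hR
  obtain ⟨σ, A, hgoods, -, hge, hne, htot⟩ := exists_allocation_sum_total_le I M R hM hRM hR1
    (fun i j => hef j i) zero_le_one (fun i => by simpa using hpool i) hmatch
  refine ⟨A, fun i j => ⟨fun hj => Or.inr fun g hg => ?_, fun hj => (hne j).resolve_left hj i⟩, ?_⟩
  · rw [I.utility_eq_of_frac_eq_zero i (B := (A.bundle j).remove g) hj]
    rw [hgoods] at hg
    refine le_trans ?_ ((hefx i (σ j) g hg).trans (hge i))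
    simp [Bundle.remove, hgoods]
  · rw [div_le_iff₀ (by positivity)]
    linarith

theorem exists_complete_EFM_sum_total_le {n : ℕ} (hn : 1 ≤ n) (I : Instance n) :
    ∃ A : Allocation I, A.IsComplete ∧ EFM I A ∧ (∑ i, I.total i) / (2 * n) ≤ A.welfare := by
  classical
  have : NeZero n := ⟨by omega⟩
  obtain ⟨N, hN, hNmax⟩ := exists_max_image
    ((univ : Finset (Fin n → Finset (Fin I.m))).filter fun N =>
      Pairwise (fun i j => Disjoint (N i) (N j)) ∧ ∀ i, #(N i) ≤ 1)
    (fun N => ∑ i, ∑ g ∈ N i, I.uInd i g)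
    ⟨fun _ => ∅, mem_filter.mpr ⟨mem_univ _, by simp [Pairwise]⟩⟩
  obtain ⟨hNdisj, hN1⟩ := (mem_filter.mp hN).2
  obtain ⟨M, R, hM, hcompl, hRM, hR1, hef, hwel⟩ :=
    exists_complete_uniform_ef1 I.uInd I.uInd_nonneg N hNdisj hN1
  obtain ⟨σ, A, hgoods, hfrac, hge, hne, htot⟩ := exists_allocation_sum_total_le I M R hM hRM hR1
    hef le_rfl (fun i => by simp [hcompl])
    fun N' h h' => (hNmax N' (mem_filter.mpr ⟨mem_univ _, h, h'⟩)).trans hwel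
  refine ⟨A, ⟨fun g => ?_, hfrac⟩,
    fun i j => ⟨fun hj => ?_, fun hj => (hne j).resolve_left hj i⟩, ?_⟩
  · obtain ⟨j, -, hj⟩ := mem_biUnion.mp (hcompl ▸ mem_univ g)
    exact ⟨σ.symm j, by simpa [hgoods] using hj⟩
  · have hbound := (hef i (σ j)).trans (hge i)
    rcases (R (σ j)).eq_empty_or_nonempty with hR | ⟨g, hg⟩
    · left
      rw [I.utility_eq_of_frac_eq_zero i hj, hgoods]
      simpa [hR] using hbound
    · right
      have hRg : R (σ j) = {g} :=
        eq_singleton_iff_unique_mem.mpr ⟨hg, fun x hx => card_le_one.mp (hR1 _) x hx g hg⟩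
      refine ⟨g, by rw [hgoods]; exact hRM _ hg, ?_⟩
      rw [I.utility_eq_of_frac_eq_zero i (B := (A.bundle j).remove g) hj]
      simpa [Bundle.remove, hgoods, hRg, sdiff_singleton_eq_erase] using hbound
  · have : (0 : ℝ) < n := by exact_mod_cast hn
    rw [div_le_iff₀ (by positivity)]
    linarith

/-! ### Bounds for the price of fairness -/

theorem le_bestWelfare {n : ℕ} {I : Instance n} {P : Allocation I → Prop} {A : Allocation I}
    (hA : P A) : ENNReal.ofReal A.welfare ≤ bestWelfare I P :=
  le_iSup₂ (f := fun (A : Allocation I) (_ : P A) => ENNReal.ofReal A.welfare) A hA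

theorem bestWelfare_mono {n : ℕ} {I : Instance n} {P Q : Allocation I → Prop}
    (h : ∀ A, P A → Q A) : bestWelfare I P ≤ bestWelfare I Q :=
  iSup₂_le fun A hA => le_bestWelfare (h A hA)

theorem price_le_of_exists_sum_total_le {P : ∀ {n : ℕ} (I : Instance n), Allocation I → Prop}
    {n : ℕ} {C : ℝ} (hC : 0 ≤ C)
    (h : ∀ I : Instance n, ∃ A, P I A ∧ ∑ i, I.total i ≤ C * A.welfare) :
    price P n ≤ ENNReal.ofReal C := by
  refine iSup_le fun I => ENNReal.div_le_of_le_mul (iSup₂_le fun A _ => ?_)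
  obtain ⟨B, hB, hle⟩ := h I
  calc ENNReal.ofReal A.welfare ≤ ENNReal.ofReal (C * B.welfare) :=
        ENNReal.ofReal_le_ofReal (A.welfare_le_sum_total.trans hle)
    _ = ENNReal.ofReal C * ENNReal.ofReal B.welfare := ENNReal.ofReal_mul hC
    _ ≤ ENNReal.ofReal C * bestWelfare I (P I) := by gcongr; exact le_bestWelfare hB

theorem EFXM.efm {n : ℕ} {I : Instance n} {A : Allocation I} (h : EFXM I A) : EFM I A := by
  intro i j
  refine ⟨fun hj => ?_, (h i j).2⟩
  rcases (h i j).1 hj with hle | hle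
  · exact Or.inl hle
  · rcases (A.bundle j).goods.eq_empty_or_nonempty with he | ⟨g, hg⟩
    · left
      rw [I.utility_eq_of_frac_eq_zero i hj, he, sum_empty]
      exact I.utility_nonneg i _
    · exact Or.inr ⟨g, hg, hle g hg⟩

theorem EFM.ef1 {n : ℕ} {I : Instance n} {A : Allocation I} (h : EFM I A) : EF1 I A := by
  intro i j hj
  have henvy : I.utility i (A.bundle j) ≤ I.utility i (A.bundle i) ∨
      ∃ g ∈ (A.bundle j).goods, I.utility i ((A.bundle j).remove g) ≤ I.utility i (A.bundle i) := by
    by_cases hf : (A.bundle j).frac = 0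
    · exact (h i j).1 hf
    · exact Or.inl ((h i j).2 hf)
  rcases henvy with hle | hle
  · obtain ⟨g, hg⟩ := hj
    exact ⟨g, hg, (I.utility_remove_le i _ g).trans hle⟩
  · exact hle

theorem priceIndivisible_le_price {P Q : ∀ {n : ℕ} (I : Instance n), Allocation I → Prop}
    (h : ∀ {n : ℕ} (I : Instance n) (A : Allocation I), Q I A → P I A) (n : ℕ) :
    priceIndivisible P n ≤ price Q n :=
  iSup₂_le fun I _ => (ENNReal.div_le_div_left (bestWelfare_mono (h I)) _).trans
    (le_iSup (fun I : Instance n => priceFor I (Q I)) I)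

/-- An instance with `n` indivisible goods, each of value `1` to agent `0` and `1 / n` to every
other agent. -/
noncomputable def oneRichAgent (n : ℕ) [NeZero n] : Instance n where
  m := n
  k := 0
  uInd := fun i _ => if i = 0 then 1 else 1 / n
  uDiv := fun _ _ => 0
  uInd_nonneg := fun i _ => by split_ifs <;> positivity
  uDiv_nonneg := fun _ _ => le_rfl

theorem oneRichAgent_utility {n : ℕ} [NeZero n] (i : Fin n)
    (B : Bundle (oneRichAgent n).m (oneRichAgent n).k) :
    (oneRichAgent n).utility i B = #B.goods * if i = 0 then 1 else 1 / (n : ℝ) := by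
  have h : ∑ d, B.frac d * (oneRichAgent n).uDiv i d = 0 :=
    sum_eq_zero fun d _ => mul_zero _
  rw [Instance.utility, h, add_zero]
  change ∑ g ∈ B.goods, (if i = 0 then (1 : ℝ) else 1 / n) = _
  rw [sum_const, nsmul_eq_mul]

/-- If agent `0` had two goods, then by EF1 every other agent would have at least one, which makes
more than `n` goods. -/
theorem EF1.welfare_oneRichAgent_le {n : ℕ} [NeZero n] {A : Allocation (oneRichAgent n)}
    (hA : EF1 _ A) : A.welfare ≤ 2 := by
  have hn : (0 : ℝ) < n := by exact_mod_cast Nat.pos_of_neZero n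
  have hcard : ∑ i, #(A.bundle i).goods ≤ n := by
    rw [← card_biUnion fun i _ j _ hij => A.disjoint i j hij]
    exact (card_le_univ _).trans_eq (Fintype.card_fin n)
  have hzero : #(A.bundle 0).goods ≤ 1 := by
    by_contra! h2
    have hone : ∀ i, 1 ≤ #(A.bundle i).goods := fun i => by
      obtain ⟨g, hg, hle⟩ := hA i 0 (card_pos.mp (by omega))
      rw [oneRichAgent_utility, oneRichAgent_utility] at hle
      have hle' := le_of_mul_le_mul_right hle (by split_ifs <;> positivity)
      have hrem : #((A.bundle 0).remove g).goods = #(A.bundle 0).goods - 1 :=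
        card_erase_of_mem hg
      rw [hrem] at hle'
      have : #(A.bundle 0).goods - 1 ≤ #(A.bundle i).goods := by exact_mod_cast hle'
      omega
    have : ∑ _i : Fin n, 1 < ∑ i, #(A.bundle i).goods :=
      sum_lt_sum (fun i _ => hone i) ⟨0, mem_univ _, h2⟩
    simp at this
    omega
  have hterm : ∀ i, (oneRichAgent n).utility i (A.bundle i) ≤
      (if i = 0 then 1 else 0) + #(A.bundle i).goods * (1 / (n : ℝ)) := fun i => by
    rw [oneRichAgent_utility]
    by_cases hi : i = 0
    · subst hi
      have h1 : (#(A.bundle 0).goods : ℝ) ≤ 1 := by exact_mod_cast hzero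
      have h2 : 0 ≤ #(A.bundle 0).goods * (1 / (n : ℝ)) := by positivity
      simp only [if_true, mul_one]
      linarith
    · simp [hi]
  calc A.welfare ≤ ∑ i, ((if i = 0 then 1 else 0) + #(A.bundle i).goods * (1 / (n : ℝ))) :=
        sum_le_sum fun i _ => hterm i
    _ = 1 + (∑ i, #(A.bundle i).goods : ℕ) * (1 / (n : ℝ)) := by
        rw [sum_add_distrib, ← sum_mul]
        simp
    _ ≤ 1 + n * (1 / (n : ℝ)) := by gcongr
    _ = 2 := by rw [mul_one_div_cancel hn.ne']; norm_num

theorem le_optWelfare_oneRichAgent (n : ℕ) [NeZero n] :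
    ENNReal.ofReal n ≤ optWelfare (oneRichAgent n) := by
  let A : Allocation (oneRichAgent n) :=
    { bundle := fun i =>
        { goods := if i = 0 then univ else ∅
          frac := 0
          frac_mem := fun _ => by simp }
      disjoint := fun i j hij => by
        by_cases hi : i = 0
        · have hj : j ≠ 0 := fun hj => hij (hi.trans hj.symm)
          simp [hj]
        · simp [hi]
      sum_frac_le := fun _ => by simp }
  refine le_trans (ENNReal.ofReal_le_ofReal ?_) (le_bestWelfare (A := A) trivial)
  calc (n : ℝ) = (oneRichAgent n).utility 0 (A.bundle 0) := by
        rw [oneRichAgent_utility]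
        simp only [A, if_true, mul_one]
        exact_mod_cast (Finset.card_fin n).symm
    _ ≤ A.welfare :=
        single_le_sum (f := fun i => (oneRichAgent n).utility i (A.bundle i))
          (fun i _ => Instance.utility_nonneg _ i _) (mem_univ 0)

theorem le_priceIndivisible_EF1 {n : ℕ} (hn : 1 ≤ n) :
    ENNReal.ofReal (1 / 2 * n) ≤ priceIndivisible EF1 n := by
  have : NeZero n := ⟨by omega⟩
  refine le_trans ?_ (le_iSup₂ (f := fun (I : Instance n) (_ : I.k = 0) => priceFor I (EF1 I))
    (oneRichAgent n) rfl)
  have hbest : bestWelfare (oneRichAgent n) (EF1 _) ≤ ENNReal.ofReal 2 :=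
    iSup₂_le fun A hA => ENNReal.ofReal_le_ofReal hA.welfare_oneRichAgent_le
  calc ENNReal.ofReal (1 / 2 * n) = ENNReal.ofReal n / ENNReal.ofReal 2 := by
        rw [← ENNReal.ofReal_div_of_pos two_pos]
        congr 1
        ring
    _ ≤ priceFor (oneRichAgent n) (EF1 _) :=
        ENNReal.div_le_div (le_optWelfare_oneRichAgent n) hbest

theorem isThetaLinear_price {P : ∀ {n : ℕ} (I : Instance n), Allocation I → Prop}
    (hP : ∀ {n : ℕ} (I : Instance n) (A : Allocation I), P I A → EF1 I A)
    (h : ∀ {n : ℕ}, 1 ≤ n → ∀ I : Instance n,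
      ∃ A, P I A ∧ (∑ i, I.total i) / (2 * n + 1) ≤ A.welfare) :
    IsThetaLinear (price P) := by
  refine ⟨1 / 2, 3, by norm_num, by norm_num, fun n hn => ⟨?_, ?_⟩⟩
  · exact (le_priceIndivisible_EF1 hn).trans (priceIndivisible_le_price hP n)
  · refine price_le_of_exists_sum_total_le (by positivity) fun I => ?_
    obtain ⟨A, hA, hle⟩ := h hn I
    refine ⟨A, hA, ?_⟩
    have hwel : 0 ≤ A.welfare := sum_nonneg fun i _ => I.utility_nonneg i _
    have hn' : (1 : ℝ) ≤ n := by exact_mod_cast hn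
    rw [div_le_iff₀ (by positivity)] at hle
    nlinarith

end FairDivision

theorem mainTheorem5 :
    FairDivision.IsThetaLinear (FairDivision.price FairDivision.EFM) ∧
    FairDivision.IsThetaLinear (FairDivision.price FairDivision.EFXM) ∧
    (∃ c : ℝ, 0 < c ∧ ∀ n : ℕ, 1 ≤ n →
      ENNReal.ofReal (c * n) ≤ FairDivision.priceIndivisible FairDivision.EF1 n) ∧
    (∀ n : ℕ, 1 ≤ n → ∀ I : FairDivision.Instance n,
      ∃ A : FairDivision.Allocation I, FairDivision.EFXM I A ∧
        (∑ i, I.total i) / (2 * n + 1) ≤ A.welfare) ∧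
    (∀ n : ℕ, 1 ≤ n → ∀ I : FairDivision.Instance n,
      ∃ A : FairDivision.Allocation I, A.IsComplete ∧ FairDivision.EFM I A ∧
        (∑ i, I.total i) / (2 * n) ≤ A.welfare) := by
  refine ⟨?_, ?_, ⟨1 / 2, by norm_num, fun n hn => FairDivision.le_priceIndivisible_EF1 hn⟩,
    fun n hn I => FairDivision.exists_EFXM_sum_total_le hn I,
    fun n hn I => FairDivision.exists_complete_EFM_sum_total_le hn I⟩
  · refine FairDivision.isThetaLinear_price (fun I A h => h.ef1) fun hn I => ?_
    obtain ⟨A, hA, hle⟩ := FairDivision.exists_EFXM_sum_total_le hn I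
    exact ⟨A, hA.efm, hle⟩
  · exact FairDivision.isThetaLinear_price (fun I A h => h.efm.ef1) fun hn I =>
      FairDivision.exists_EFXM_sum_total_le hn I
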